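/- **Definitions.** Let $(\mathcal X,d_{\mathcal X})$ and $(\mathcal Y,d_{\mathcal Y})$ be metric spaces. A map $f:\mathcal X\to\mathcal Y$ is a *bi-Lipschitz embedding* if there are a scale $s>0$ and a number $D\ge 1$ with $$ s\,d_{\mathcal X}(x,\tilde x)\le d_{\mathcal Y}(f(x),f(\tilde x))\le s\,D\,d_{\mathcal X}(x,\tilde x)\qquad\text{for all } x,\tilde x\in\mathcal X. $$ Its *distortion* $\operatorname{Dist}(f)$ is the smallest $D\ge1$ for which this holds for some $s>0$. **Proposition (Impossibility of Manifold Embedding of Fixed Finite Dimension).** Let $\mathcal R$ be a connected smooth Riemannian manifold of finite dimension, regarded as a metric space with its geodesic distance, and suppose that there is a bi-Lipschitz embedding of $\mathcal R$ into the real Hilbert space $\ell^2$. Then there is a constant $c_{\mathcal R}>0$, depending only on $\mathcal R$, such that for every positive integer $n$ there is an $n$-point metric space $(\mathcal X,d_{\mathcal X})$ for which every bi-Lipschitz embedding $f:\mathcal X\to\mathcal R$ satisfies $$ \operatorname{Dist}(f)\ \ge\ c_{\mathcal R}\,\frac{\log n}{\log\log n}, $$ where $\log$ is the natural logarithm and the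 right-hand side is read as $0$ when $n=1$. -/

import Mathlib

open scoped Manifold ContDiff Bundle
open Bundle (RiemannianBundle)

/-- `f` is a bi-Lipschitz embedding with scale `s > 0` and distortion at most `D`, where `D ≥ 1`:
`s * d(x, y) ≤ d(f x, f y) ≤ s * D * d(x, y)` for all `x`, `y`. -/
structure IsBiLipschitzWith {X Y : Type*} [MetricSpace X] [MetricSpace Y]
    (f : X → Y) (s D : ℝ) : Prop where
  scale_pos : 0 < s
  one_le : 1 ≤ D
  lower : ∀ x y : X, s * dist x y ≤ dist (f x) (f y)
  upper : ∀ x y : X, dist (f x) (f y) ≤ s * D * dist x y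

/-- `f` is a bi-Lipschitz embedding of metric spaces. -/
def IsBiLipschitzEmbedding {X Y : Type*} [MetricSpace X] [MetricSpace Y] (f : X → Y) : Prop :=
  ∃ s D : ℝ, IsBiLipschitzWith f s D

/-- The distortion of a bi-Lipschitz embedding `f`: the least `D ≥ 1` such that, for some scale
`s > 0`, `s * d(x, y) ≤ d(f x, f y) ≤ s * D * d(x, y)` for all `x`, `y`.
(It is only used for bi-Lipschitz embeddings; then the set below is nonempty, and it is
bounded below by `1`.) -/
noncomputable def distortion {X Y : Type*} [MetricSpace X] [MetricSpace Y] (f : X → Y) : ℝ :=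
  sInf {D : ℝ | ∃ s : ℝ, IsBiLipschitzWith f s D}

/-- The real Hilbert space `ℓ²` of square-summable sequences. -/
abbrev EllTwo : Type := lp (fun _ : ℕ => ℝ) 2

/-!
Composing with the embedding of `R` reduces the theorem to embeddings into a Hilbert space. The
hard spaces are the Cayley graphs of `F ^ D`, where `F` is the field of `p` elements with
`2 * D < p ≤ 4 * D`, whose generators are the points of the `p` lines spanned by the points
`(1, x, …, x ^ (D - 1))` of the moment curve. By Vandermonde any `D` of these lines span `F ^ D`.

Averaging a Hilbert-space-valued function over the cosets of these lines gives `p` commuting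
orthogonal projections. A nonzero function of mean zero is fixed by fewer than `D` of them, as its
periods would otherwise be all of `F ^ D`; diagonalizing the projections simultaneously, one obtains
a Poincaré inequality whose constant does not depend on `D`. It bounds the mean square distance of
the image points by a constant multiple of the Lipschitz constant squared. In the graph itself,
however, a ball of radius `(D - 1) / 2` contains at most half of the points, because there are at
most `p ^ 2` generators; typical distances are thus of order `D`, and `D` is of order
`log n / log log n` for `n = p ^ D`.
-/

open scoped Finset

section BiLipschitz

variable {X Y : Type*} [MetricSpace X] [MetricSpace Y]

theorem isBiLipschitzWith_of_isometry {e : X → Y} (he : Isometry e) :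
    IsBiLipschitzWith e 1 1 where
  scale_pos := one_pos
  one_le := le_rfl
  lower x y := by rw [he.dist_eq, one_mul]
  upper x y := by rw [he.dist_eq, one_mul, one_mul]

theorem IsBiLipschitzWith.comp {Z : Type*} [MetricSpace Z] {g : Y → Z} {f : X → Y}
    {s D s' D' : ℝ} (hg : IsBiLipschitzWith g s' D') (hf : IsBiLipschitzWith f s D) :
    IsBiLipschitzWith (g ∘ f) (s' * s) (D' * D) where
  scale_pos := mul_pos hg.scale_pos hf.scale_pos
  one_le := one_le_mul_of_one_le_of_one_le hg.one_le hf.one_le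
  lower x y := by
    rw [mul_assoc]
    exact (mul_le_mul_of_nonneg_left (hf.lower x y) hg.scale_pos.le).trans (hg.lower _ _)
  upper x y := by
    have hnonneg : 0 ≤ s' * D' := mul_nonneg hg.scale_pos.le (zero_le_one.trans hg.one_le)
    calc dist (g (f x)) (g (f y)) ≤ s' * D' * dist (f x) (f y) := hg.upper _ _
      _ ≤ s' * D' * (s * D * dist x y) := by gcongr; exact hf.upper x y
      _ = s' * s * (D' * D) * dist x y := by ring

theorem le_distortion {f : X → Y} {c : ℝ} (hf : IsBiLipschitzEmbedding f)
    (hc : ∀ s D, IsBiLipschitzWith f s D → c ≤ D) : c ≤ distortion f := by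
  obtain ⟨s, D, hD⟩ := hf
  exact le_csInf ⟨D, s, hD⟩ fun D ⟨s, hD⟩ => hc s D hD

end BiLipschitz

section CommutingProjections

variable {V ι : Type*} [NormedAddCommGroup V] [InnerProductSpace ℝ V]

theorem inner_apply_self_of_isSymmetricProjection {P : V →ₗ[ℝ] V} (hP : P.IsSymmetricProjection)
    (v : V) : inner ℝ (P v) v = ‖P v‖ ^ 2 := by
  rw [← real_inner_self_eq_norm_sq, ← hP.isSymmetric, ← Module.End.mul_apply,
    hP.isIdempotentElem.eq]

theorem norm_sub_apply_sq_of_isSymmetricProjection {P : V →ₗ[ℝ] V} (hP : P.IsSymmetricProjection)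
    (v : V) : ‖v - P v‖ ^ 2 = ‖v‖ ^ 2 - inner ℝ (P v) v := by
  rw [norm_sub_sq_real, real_inner_comm, inner_apply_self_of_isSymmetricProjection hP]
  ring

theorem inner_apply_self_eq_add_of_commute {P T : V →ₗ[ℝ] V} (hP : P.IsSymmetricProjection)
    (hPT : Commute P T) (v : V) :
    inner ℝ (T v) v = inner ℝ (T (P v)) (P v) + inner ℝ (T (v - P v)) (v - P v) := by
  have hcomm (w : V) : T (P w) = P (T w) := LinearMap.congr_fun hPT.symm.eq w
  have hidem (w : V) : P (P w) = P w := LinearMap.congr_fun hP.isIdempotentElem.eq w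
  have hcross : inner ℝ (T (P v)) (P v) = inner ℝ (T v) (P v) := by
    rw [hcomm, hP.isSymmetric, hidem]
  have hcross' : inner ℝ (T (P v)) v = inner ℝ (T v) (P v) := by rw [hcomm, hP.isSymmetric]
  simp only [map_sub, inner_sub_left, inner_sub_right, hcross, hcross']
  ring

theorem sum_inner_le_of_card_fixing_le [DecidableEq V] {T : ι → V →ₗ[ℝ] V}
    (hT : ∀ i, (T i).IsSymmetricProjection) (hcomm : ∀ i j, Commute (T i) (T j)) (s : Finset ι)
    {W : Submodule ℝ V} (hW : ∀ i, W ∈ Module.End.invtSubmodule (T i)) {D : ℝ}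
    (hD : ∀ v ∈ W, v ≠ 0 → (#{i ∈ s | T i v = v} : ℝ) ≤ D) {v : V} (hv : v ∈ W) :
    ∑ i ∈ s, inner ℝ (T i v) v ≤ D * ‖v‖ ^ 2 := by
  classical
  induction s using Finset.induction_on generalizing W D v with
  | empty =>
    rcases eq_or_ne v 0 with rfl | hv0
    · simp
    · have : 0 ≤ D := by simpa using hD v hv hv0
      simpa using by positivity
  | insert x s hx ih =>
    -- Simultaneous diagonalization, done one projection at a time: splitting `W` into the range and
    -- the kernel of `T x` uses up one of the `D` permitted fixing projections on the range and none
    -- on the kernel.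
    have hcomm' (i : ι) (w : V) : T x (T i w) = T i (T x w) :=
      LinearMap.congr_fun (hcomm x i).eq w
    have hidem (w : V) : T x (T x w) = T x w :=
      LinearMap.congr_fun (hT x).isIdempotentElem.eq w
    have hfixed : ∑ i ∈ s, inner ℝ (T i (T x v)) (T x v) ≤ (D - 1) * ‖T x v‖ ^ 2 := by
      refine ih (W := W ⊓ LinearMap.eqLocus (T x) 1)
        (fun i w hw => ⟨hW i hw.1, (hcomm' i w).trans (congrArg (T i) hw.2)⟩)
        (fun w hw hw0 => ?_) ⟨hW x hv, hidem v⟩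
      have hcard := hD w hw.1 hw0
      rw [Finset.filter_insert, if_pos (show T x w = w from hw.2),
          Finset.card_insert_of_notMem (by simp [hx])] at hcard
      push_cast at hcard
      linarith
    have hkilled :
        ∑ i ∈ s, inner ℝ (T i (v - T x v)) (v - T x v) ≤ D * ‖v - T x v‖ ^ 2 := by
      refine ih (W := W ⊓ LinearMap.ker (T x))
        (fun i w hw => ⟨hW i hw.1, (hcomm' i w).trans (by rw [hw.2, map_zero])⟩)
        (fun w hw hw0 => le_trans ?_ (hD w hw.1 hw0))
        ⟨sub_mem hv (hW x hv), by simp [hidem]⟩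
      gcongr
      exact Finset.subset_insert x s
    have hinner := inner_apply_self_of_isSymmetricProjection (hT x) v
    have hpyth := norm_sub_apply_sq_of_isSymmetricProjection (hT x) v
    rw [Finset.sum_insert hx, Finset.sum_congr rfl fun i _ =>
      inner_apply_self_eq_add_of_commute (hT x) (hcomm x i) v, Finset.sum_add_distrib]
    calc inner ℝ (T x v) v + _ ≤ ‖T x v‖ ^ 2 + ((D - 1) * ‖T x v‖ ^ 2 + D * ‖v - T x v‖ ^ 2) := by
          rw [hinner]; gcongr
      _ = D * ‖v‖ ^ 2 := by rw [hpyth, hinner]; ring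

end CommutingProjections

section CosetAverage

variable {G H : Type*} [AddCommGroup G] [NormedAddCommGroup H] [InnerProductSpace ℝ H]

/-- The operator that averages a function `G → H` over the cosets of a finite subgroup `K`. It acts
on the `ℓ²` sum of copies of `H`, where it is the orthogonal projection onto the functions
that are constant on these cosets. -/
noncomputable def cosetAverage (H : Type*) [NormedAddCommGroup H] [InnerProductSpace ℝ H]
    (K : AddSubgroup G) [Fintype K] : Module.End ℝ (PiLp 2 fun _ : G => H) where
  toFun f := WithLp.toLp 2 fun u => (Fintype.card K : ℝ)⁻¹ • ∑ y : K, f (u + y)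
  map_add' f g := by
    ext u
    simp [Finset.sum_add_distrib]
  map_smul' c f := by
    ext u
    simp [← Finset.smul_sum, smul_comm c]

theorem cosetAverage_apply (K : AddSubgroup G) [Fintype K] (f : PiLp 2 fun _ : G => H) (u : G) :
    cosetAverage H K f u = (Fintype.card K : ℝ)⁻¹ • ∑ y : K, f (u + y) := rfl

theorem inv_card_smul_sum_const {α : Type*} [Fintype α] [Nonempty α] (a : H) :
    (Fintype.card α : ℝ)⁻¹ • ∑ _x : α, a = a := by
  rw [Finset.sum_const, Finset.card_univ, ← Nat.cast_smul_eq_nsmul ℝ,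
    inv_smul_smul₀ (by simp)]

theorem cosetAverage_apply_add {K : AddSubgroup G} [Fintype K] (f : PiLp 2 fun _ : G => H)
    {y : G} (hy : y ∈ K) (u : G) : cosetAverage H K f (u + y) = cosetAverage H K f u := by
  rw [cosetAverage_apply, cosetAverage_apply]
  congr 1
  exact Fintype.sum_equiv (Equiv.addLeft ⟨y, hy⟩) _ _ fun z => by simp [add_assoc]

theorem cosetAverage_eq_self_iff {K : AddSubgroup G} [Fintype K] {f : PiLp 2 fun _ : G => H} :
    cosetAverage H K f = f ↔ ∀ y ∈ K, ∀ u, f (u + y) = f u := by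
  refine ⟨fun hf y hy u => hf ▸ cosetAverage_apply_add f hy u, fun hf => ?_⟩
  ext u
  rw [cosetAverage_apply, Finset.sum_congr rfl fun (y : K) _ => hf y y.2 u,
    inv_card_smul_sum_const]

theorem isIdempotentElem_cosetAverage (K : AddSubgroup G) [Fintype K] :
    IsIdempotentElem (cosetAverage H K) :=
  LinearMap.ext fun f => cosetAverage_eq_self_iff.2 fun _ hy => cosetAverage_apply_add f hy

theorem commute_cosetAverage (K L : AddSubgroup G) [Fintype K] [Fintype L] :
    Commute (cosetAverage H K) (cosetAverage H L) := by
  refine LinearMap.ext fun f => ?_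
  ext u
  simp only [Module.End.mul_apply, cosetAverage_apply, ← Finset.smul_sum]
  rw [Finset.sum_comm, smul_comm]
  simp only [add_right_comm]

theorem norm_sub_cosetAverage_apply_le {K : AddSubgroup G} [Fintype K]
    {f : PiLp 2 fun _ : G => H} {u : G} {L : ℝ} (hL : ∀ y ∈ K, ‖f (u + y) - f u‖ ≤ L) :
    ‖f u - cosetAverage H K f u‖ ≤ L := by
  have hK : (0 : ℝ) < Fintype.card K := by exact_mod_cast Fintype.card_pos
  have hdiff : f u - cosetAverage H K f u =
      (Fintype.card K : ℝ)⁻¹ • ∑ y : K, (f u - f (u + y)) := by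
    rw [Finset.sum_sub_distrib, smul_sub, inv_card_smul_sum_const, cosetAverage_apply]
  rw [hdiff, norm_smul, norm_inv, Real.norm_natCast, inv_mul_le_iff₀ hK]
  calc ‖∑ y : K, (f u - f (u + y))‖ ≤ ∑ _y : K, L :=
        norm_sum_le_of_le _ fun y _ => by rw [norm_sub_rev]; exact hL y y.2
    _ = Fintype.card K * L := by simp

/-- The `H`-valued functions of mean zero: the orthogonal complement of the constants, on
which the Poincaré inequality is proved. -/
def meanZero (α H : Type*) [Fintype α] [NormedAddCommGroup H] [InnerProductSpace ℝ H] :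
    Submodule ℝ (PiLp 2 fun _ : α => H) where
  carrier := {f | ∑ u, f u = 0}
  zero_mem' := by simp
  add_mem' {f g} hf hg := by
    simp_all [Finset.sum_add_distrib]
  smul_mem' c f hf := by
    simp_all [← Finset.smul_sum]

theorem mem_meanZero {α : Type*} [Fintype α] {f : PiLp 2 fun _ : α => H} :
    f ∈ meanZero α H ↔ ∑ u, f u = 0 := Iff.rfl

variable [Fintype G]

theorem isSymmetric_cosetAverage (K : AddSubgroup G) [Fintype K] :
    (cosetAverage H K).IsSymmetric := by
  intro f g
  simp only [PiLp.inner_apply, cosetAverage_apply, inner_smul_left, inner_smul_right, sum_inner,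
    inner_sum, ← Finset.mul_sum]
  congr 1
  refine Finset.sum_comm.trans (Eq.trans ?_ Finset.sum_comm)
  refine Fintype.sum_equiv (Equiv.neg K) _ _ fun y => ?_
  exact Fintype.sum_equiv (Equiv.addRight (y : G)) _ _ fun u => by simp

theorem isSymmetricProjection_cosetAverage (K : AddSubgroup G) [Fintype K] :
    (cosetAverage H K).IsSymmetricProjection :=
  ⟨isIdempotentElem_cosetAverage K, isSymmetric_cosetAverage K⟩

theorem sum_cosetAverage (K : AddSubgroup G) [Fintype K] (f : PiLp 2 fun _ : G => H) :
    ∑ u, cosetAverage H K f u = ∑ u, f u := by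
  have hshift (y : G) : ∑ u, f (u + y) = ∑ u, f u :=
    Fintype.sum_equiv (Equiv.addRight y) _ _ fun u => rfl
  simp only [cosetAverage_apply, ← Finset.smul_sum]
  rw [Finset.sum_comm, Finset.sum_congr rfl fun (y : K) _ => hshift y, inv_card_smul_sum_const]

theorem meanZero_mem_invtSubmodule_cosetAverage (K : AddSubgroup G) [Fintype K] :
    meanZero G H ∈ Module.End.invtSubmodule (cosetAverage H K) :=
  fun f hf => (sum_cosetAverage K f).trans hf

theorem eq_zero_of_mem_meanZero_of_cosetAverage_eq_self {ι : Type*} {K : ι → AddSubgroup G}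
    [∀ i, Fintype (K i)] {t : Finset ι} (ht : ⨆ i ∈ t, K i = ⊤) {f : PiLp 2 fun _ : G => H}
    (hmean : f ∈ meanZero G H) (hf : ∀ i ∈ t, cosetAverage H (K i) f = f) : f = 0 := by
  let periods : AddSubgroup G :=
    { carrier := {v | ∀ u, f (u + v) = f u}
      zero_mem' := by simp
      add_mem' := fun {v w} hv hw u => by rw [← add_assoc, hw, hv]
      neg_mem' := fun {v} hv u => by rw [← hv (u + -v), neg_add_cancel_right] }
  have hperiods : periods = ⊤ :=
    top_le_iff.1 (ht ▸ iSup₂_le fun i hi y hy => cosetAverage_eq_self_iff.1 (hf i hi) y hy)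
  have hconst (u : G) : f u = f 0 := by
    simpa using (hperiods ▸ AddSubgroup.mem_top u : u ∈ periods) 0
  ext u
  rw [hconst u, ← inv_card_smul_sum_const (α := G) (f 0),
    ← Finset.sum_congr rfl fun v _ => hconst v, mem_meanZero.1 hmean, smul_zero, PiLp.zero_apply]

end CosetAverage

section Poincare

variable {G H ι : Type*} [AddCommGroup G] [Fintype G] [NormedAddCommGroup H]
  [InnerProductSpace ℝ H] [Fintype ι]

theorem sum_norm_sq_le_of_mem_meanZero {K : ι → AddSubgroup G} {D : ℕ}
    (hK : ∀ t : Finset ι, D ≤ #t → ⨆ i ∈ t, K i = ⊤) {f : PiLp 2 fun _ : G => H}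
    (hmean : f ∈ meanZero G H) {L : ℝ} (hL : ∀ i, ∀ y ∈ K i, ∀ u, ‖f (u + y) - f u‖ ≤ L) :
    ((Fintype.card ι : ℝ) - D) * ∑ u, ‖f u‖ ^ 2 ≤ Fintype.card ι * Fintype.card G * L ^ 2 := by
  classical
  have hspectral : ∑ i, inner ℝ (cosetAverage H (K i) f) f ≤ D * ‖f‖ ^ 2 := by
    refine sum_inner_le_of_card_fixing_le (fun i => isSymmetricProjection_cosetAverage (K i))
      (fun i j => commute_cosetAverage (K i) (K j)) Finset.univ
      (fun i => meanZero_mem_invtSubmodule_cosetAverage (K i)) (fun g hg hg0 => ?_) hmean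
    by_contra! hcard
    exact hg0 (eq_zero_of_mem_meanZero_of_cosetAverage_eq_self (hK _ (Nat.cast_le.1 hcard.le)) hg
      fun i hi => (Finset.mem_filter.1 hi).2)
  have hlocal (i : ι) :
      ‖f‖ ^ 2 - inner ℝ (cosetAverage H (K i) f) f ≤ Fintype.card G * L ^ 2 := by
    rw [← norm_sub_apply_sq_of_isSymmetricProjection (isSymmetricProjection_cosetAverage (K i)),
      PiLp.norm_sq_eq_of_L2]
    calc ∑ u, ‖(f - cosetAverage H (K i) f) u‖ ^ 2 ≤ ∑ _u : G, L ^ 2 := by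
          gcongr with u
          exact norm_sub_cosetAverage_apply_le fun y hy => hL i y hy u
      _ = Fintype.card G * L ^ 2 := by simp
  have hsum := Finset.sum_le_sum fun i (_ : i ∈ Finset.univ) => hlocal i
  simp only [Finset.sum_sub_distrib, Finset.sum_const, Finset.card_univ, nsmul_eq_mul] at hsum
  rw [← PiLp.norm_sq_eq_of_L2]
  linarith

theorem sum_sum_norm_sub_sq_eq_of_sum_eq_zero {α : Type*} [Fintype α] {f : α → H}
    (hf : ∑ u, f u = 0) :
    ∑ u, ∑ v, ‖f u - f v‖ ^ 2 = 2 * Fintype.card α * ∑ u, ‖f u‖ ^ 2 := by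
  simp only [norm_sub_sq_real, Finset.sum_add_distrib, Finset.sum_sub_distrib, ← Finset.mul_sum,
    ← inner_sum, hf, inner_zero_right, Finset.sum_const, Finset.card_univ, nsmul_eq_mul]
  ring

theorem poincare_of_iSup_eq_top {K : ι → AddSubgroup G} {D : ℕ}
    (hK : ∀ t : Finset ι, D ≤ #t → ⨆ i ∈ t, K i = ⊤) {f : G → H} {L : ℝ}
    (hL : ∀ i, ∀ y ∈ K i, ∀ u, ‖f (u + y) - f u‖ ≤ L) :
    ((Fintype.card ι : ℝ) - D) * ∑ u, ∑ v, ‖f u - f v‖ ^ 2 ≤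
      2 * Fintype.card ι * Fintype.card G ^ 2 * L ^ 2 := by
  let mean : H := (Fintype.card G : ℝ)⁻¹ • ∑ u, f u
  let g : PiLp 2 fun _ : G => H := WithLp.toLp 2 fun u => f u - mean
  have hg_sub (u v : G) : g u - g v = f u - f v := sub_sub_sub_cancel_right _ _ _
  have hg_mean : ∑ u, g u = 0 := by
    change ∑ u, (f u - mean) = 0
    rw [Finset.sum_sub_distrib, sub_eq_zero, Finset.sum_const, Finset.card_univ,
      ← Nat.cast_smul_eq_nsmul ℝ, smul_inv_smul₀ (by simp)]
  have hcentered := sum_norm_sq_le_of_mem_meanZero hK (mem_meanZero.2 hg_mean)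
    fun i y hy u => (hg_sub (u + y) u).symm ▸ hL i y hy u
  simp only [← hg_sub]
  rw [sum_sum_norm_sub_sq_eq_of_sum_eq_zero hg_mean]
  calc _ = 2 * (Fintype.card G : ℝ) * (((Fintype.card ι : ℝ) - D) * ∑ u, ‖g u‖ ^ 2) := by ring
    _ ≤ 2 * (Fintype.card G : ℝ) * (Fintype.card ι * Fintype.card G * L ^ 2) := by gcongr
    _ = _ := by ring

end Poincare

section DistortionOfNormedGroup

variable {G H ι : Type*} [NormedAddCommGroup G] [Fintype G] [NormedAddCommGroup H]
  [InnerProductSpace ℝ H] [Fintype ι] {ρ : ℝ}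

theorem card_sq_mul_sq_le_sum_sum_norm_sub_sq (hρ : 0 ≤ ρ)
    (hball : 2 * #{u : G | ‖u‖ < ρ} ≤ Fintype.card G) :
    (Fintype.card G : ℝ) ^ 2 * ρ ^ 2 ≤ 2 * ∑ u : G, ∑ v : G, ‖u - v‖ ^ 2 := by
  have hfar : (Fintype.card G : ℝ) ≤ 2 * #{u : G | ¬‖u‖ < ρ} := by
    have := Finset.card_filter_add_card_filter_not (s := (Finset.univ : Finset G)) (‖·‖ < ρ)
    rw [Finset.card_univ] at this
    exact_mod_cast (by omega : Fintype.card G ≤ 2 * #{u : G | ¬‖u‖ < ρ})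
  have hmoment : Fintype.card G * ρ ^ 2 ≤ 2 * ∑ u : G, ‖u‖ ^ 2 := by
    calc (Fintype.card G : ℝ) * ρ ^ 2 ≤ 2 * #{u : G | ¬‖u‖ < ρ} * ρ ^ 2 := by gcongr
      _ = 2 * ∑ _u ∈ ({u | ¬‖u‖ < ρ} : Finset G), ρ ^ 2 := by simp [mul_assoc]
      _ ≤ 2 * ∑ u : G with ¬‖u‖ < ρ, ‖u‖ ^ 2 := by
          gcongr with u hu
          exact not_lt.1 (Finset.mem_filter.1 hu).2
      _ ≤ 2 * ∑ u : G, ‖u‖ ^ 2 := by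
          gcongr
          exact Finset.filter_subset _ _
  have htranslate (v : G) : ∑ u : G, ‖u - v‖ ^ 2 = ∑ u : G, ‖u‖ ^ 2 :=
    Fintype.sum_equiv (Equiv.subRight v) _ _ fun _ => rfl
  rw [Finset.sum_comm, Finset.sum_congr rfl fun v _ => htranslate v, Finset.sum_const,
    Finset.card_univ, nsmul_eq_mul]
  calc (Fintype.card G : ℝ) ^ 2 * ρ ^ 2 = Fintype.card G * (Fintype.card G * ρ ^ 2) := by ring
    _ ≤ Fintype.card G * (2 * ∑ u : G, ‖u‖ ^ 2) := by gcongr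
    _ = _ := by ring

theorem IsBiLipschitzWith.le_three_mul_of_iSup_eq_top [Nonempty ι] {K : ι → AddSubgroup G} {D : ℕ}
    (hK : ∀ t : Finset ι, D ≤ #t → ⨆ i ∈ t, K i = ⊤) (hD : 2 * D ≤ Fintype.card ι)
    (hK_norm : ∀ i, ∀ y ∈ K i, ‖y‖ ≤ 1) (hρ : 0 ≤ ρ)
    (hball : 2 * #{u : G | ‖u‖ < ρ} ≤ Fintype.card G) {f : G → H} {s C : ℝ}
    (hf : IsBiLipschitzWith f s C) : ρ ≤ 3 * C := by
  have hs := hf.scale_pos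
  have hC := zero_le_one.trans hf.one_le
  have hlocal (i : ι) (y : G) (hy : y ∈ K i) (u : G) : ‖f (u + y) - f u‖ ≤ s * C := by
    rw [← dist_eq_norm]
    refine (hf.upper _ _).trans (mul_le_of_le_one_right (by positivity) ?_)
    simpa using hK_norm i y hy
  have hupper : ∑ u, ∑ v, ‖f u - f v‖ ^ 2 ≤ 4 * (Fintype.card G : ℝ) ^ 2 * (s * C) ^ 2 := by
    have hD' : (Fintype.card ι : ℝ) / 2 ≤ Fintype.card ι - D := by
      have : 2 * (D : ℝ) ≤ Fintype.card ι := mod_cast hD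
      linarith
    refine le_of_mul_le_mul_left (a := (Fintype.card ι : ℝ) / 2) ?_ (by positivity)
    calc _ ≤ ((Fintype.card ι : ℝ) - D) * ∑ u, ∑ v, ‖f u - f v‖ ^ 2 := by gcongr
      _ ≤ 2 * Fintype.card ι * Fintype.card G ^ 2 * (s * C) ^ 2 :=
          poincare_of_iSup_eq_top hK hlocal
      _ = _ := by ring
  have hlower : s ^ 2 * ∑ u : G, ∑ v : G, ‖u - v‖ ^ 2 ≤ ∑ u, ∑ v, ‖f u - f v‖ ^ 2 := by
    simp only [Finset.mul_sum, ← mul_pow, ← dist_eq_norm]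
    gcongr with u _ v _
    exact hf.lower u v
  have hsq : ρ ^ 2 ≤ 8 * C ^ 2 := by
    refine le_of_mul_le_mul_left (a := s ^ 2 * (Fintype.card G : ℝ) ^ 2) ?_ (by positivity)
    calc _ = s ^ 2 * ((Fintype.card G : ℝ) ^ 2 * ρ ^ 2) := by ring
      _ ≤ s ^ 2 * (2 * ∑ u : G, ∑ v : G, ‖u - v‖ ^ 2) := by
          gcongr s ^ 2 * ?_
          exact card_sq_mul_sq_le_sum_sum_norm_sub_sq hρ hball
      _ = 2 * (s ^ 2 * ∑ u : G, ∑ v : G, ‖u - v‖ ^ 2) := by ring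
      _ ≤ 2 * (4 * (Fintype.card G : ℝ) ^ 2 * (s * C) ^ 2) := by
          gcongr 2 * ?_
          exact hlower.trans hupper
      _ = _ := by ring
  exact le_of_sq_le_sq (by nlinarith) (by positivity)

end DistortionOfNormedGroup

section WordNorm

open scoped Pointwise

variable {G : Type*} [AddCommGroup G] [DecidableEq G] {B : Finset G}

/-- The length of a shortest word in the letters `B` with value `g`; it is only used when every `g`
is the value of some word (otherwise the infimum is over the empty set and equals `0`). -/
noncomputable def wordLength (B : Finset G) (g : G) : ℕ := sInf {r : ℕ | g ∈ r • B}

theorem wordLength_le {g : G} {r : ℕ} (hg : g ∈ r • B) : wordLength B g ≤ r :=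
  Nat.sInf_le hg

theorem neg_mem_nsmul (hneg : -B = B) {g : G} {r : ℕ} (hg : g ∈ r • B) : -g ∈ r • B := by
  simpa [← neg_nsmul, hneg] using Finset.neg_mem_neg hg

theorem exists_mem_nsmul_of_closure_eq_top (hneg : -B = B)
    (hgen : AddSubgroup.closure (B : Set G) = ⊤) (g : G) : ∃ r : ℕ, g ∈ r • B := by
  have hg : g ∈ AddSubgroup.closure (B : Set G) := hgen ▸ AddSubgroup.mem_top g
  induction hg using AddSubgroup.closure_induction with
  | mem g hg => exact ⟨1, by simpa using hg⟩
  | zero => exact ⟨0, by simp⟩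
  | add g h _ _ hg hh =>
    obtain ⟨m, hm⟩ := hg
    obtain ⟨n, hn⟩ := hh
    exact ⟨m + n, add_nsmul B m n ▸ Finset.add_mem_add hm hn⟩
  | neg g _ hg =>
    obtain ⟨m, hm⟩ := hg
    exact ⟨m, neg_mem_nsmul hneg hm⟩

theorem mem_wordLength_nsmul (hneg : -B = B) (hgen : AddSubgroup.closure (B : Set G) = ⊤) (g : G) :
    g ∈ wordLength B g • B :=
  Nat.sInf_mem (s := {r : ℕ | g ∈ r • B}) (exists_mem_nsmul_of_closure_eq_top hneg hgen g)

/-- The word length with respect to a finite symmetric generating set, as a norm on an abelian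
group; the metric it induces is the graph metric of the Cayley graph. -/
noncomputable def wordNorm (B : Finset G) (hneg : -B = B)
    (hgen : AddSubgroup.closure (B : Set G) = ⊤) : AddGroupNorm G where
  toFun g := wordLength B g
  map_zero' := by
    have : wordLength B (0 : G) ≤ 0 := wordLength_le (by simp)
    simpa using this
  add_le' g h := by
    have : wordLength B (g + h) ≤ wordLength B g + wordLength B h :=
      wordLength_le <| add_nsmul B _ _ ▸
        Finset.add_mem_add (mem_wordLength_nsmul hneg hgen g) (mem_wordLength_nsmul hneg hgen h)
    exact_mod_cast this
  neg' g := by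
    have hle (h : G) : wordLength B (-h) ≤ wordLength B h :=
      wordLength_le (neg_mem_nsmul hneg (mem_wordLength_nsmul hneg hgen h))
    exact congrArg _ (le_antisymm (hle g) (by simpa using hle (-g)))
  eq_zero_of_map_eq_zero' g hg := by
    have hmem := mem_wordLength_nsmul hneg hgen g
    rw [Nat.cast_eq_zero.1 hg, zero_nsmul] at hmem
    exact Finset.mem_zero.1 hmem

theorem wordNorm_apply (hneg : -B = B) (hgen : AddSubgroup.closure (B : Set G) = ⊤) (g : G) :
    wordNorm B hneg hgen g = wordLength B g := rfl

theorem card_wordLength_le [Fintype G] (hneg : -B = B)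
    (hgen : AddSubgroup.closure (B : Set G) = ⊤) (h0 : 0 ∈ B) (r : ℕ) :
    #{g | wordLength B g ≤ r} ≤ #B ^ r := by
  refine (Finset.card_le_card fun g hg => ?_).trans (Finset.card_nsmul_le (s := B) (n := r))
  exact Finset.nsmul_subset_nsmul_right h0 (Finset.mem_filter.1 hg).2
    (mem_wordLength_nsmul hneg hgen g)

end WordNorm

section SubgroupFamily

universe u

open scoped Pointwise

variable {G ι : Type*} [AddCommGroup G] [Finite G]

/-- The union of a family of subgroups of a finite abelian group, used as the generating set of a
Cayley graph. -/
noncomputable def subgroupUnion (K : ι → AddSubgroup G) : Finset G :=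
  (Set.toFinite (⋃ i, (K i : Set G))).toFinset

theorem mem_subgroupUnion {K : ι → AddSubgroup G} {g : G} :
    g ∈ subgroupUnion K ↔ ∃ i, g ∈ K i := by
  simp [subgroupUnion]

theorem neg_subgroupUnion [DecidableEq G] (K : ι → AddSubgroup G) :
    -subgroupUnion K = subgroupUnion K := by
  ext g
  simp [mem_subgroupUnion]

theorem closure_subgroupUnion (K : ι → AddSubgroup G) :
    AddSubgroup.closure (subgroupUnion K : Set G) = ⨆ i, K i := by
  simp [subgroupUnion, AddSubgroup.iSup_eq_closure]

theorem card_subgroupUnion_le [Fintype ι] {K : ι → AddSubgroup G} {q : ℕ}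
    (hq : ∀ i, Nat.card (K i) ≤ q) : #(subgroupUnion K) ≤ Fintype.card ι * q := by
  classical
  have := Fintype.ofFinite G
  have hunion : subgroupUnion K = Finset.univ.biUnion fun i => (K i : Set G).toFinset := by
    ext g
    simp [mem_subgroupUnion]
  rw [hunion]
  refine Finset.card_biUnion_le_card_mul _ _ _ fun i _ => ?_
  rw [Set.toFinset_card, ← Nat.card_eq_fintype_card]
  exact hq i

theorem exists_metricSpace_le_three_mul_of_iSup_eq_top {G ι : Type*} [AddCommGroup G] [Fintype G]
    [Fintype ι] [Nonempty ι] {K : ι → AddSubgroup G} {D q r : ℕ}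
    (hK : ∀ t : Finset ι, D ≤ #t → ⨆ i ∈ t, K i = ⊤) (hD : 2 * D ≤ Fintype.card ι)
    (hq : ∀ i, Nat.card (K i) ≤ q) (hr : 2 * (Fintype.card ι * q) ^ r ≤ Fintype.card G) :
    ∃ _ : MetricSpace G, ∀ {H : Type u} [NormedAddCommGroup H] [InnerProductSpace ℝ H]
      {f : G → H} {s C : ℝ}, IsBiLipschitzWith f s C → (r : ℝ) + 1 ≤ 3 * C := by
  classical
  have hneg := neg_subgroupUnion K
  have hgen : AddSubgroup.closure (subgroupUnion K : Set G) = ⊤ := by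
    rw [closure_subgroupUnion]
    simpa using hK Finset.univ (by rw [Finset.card_univ]; omega)
  let _ : NormedAddCommGroup G := (wordNorm _ hneg hgen).toNormedAddCommGroup
  have hnorm (g : G) : ‖g‖ = wordLength (subgroupUnion K) g := wordNorm_apply hneg hgen g
  have hnorm_le_one (i : ι) (y : G) (hy : y ∈ K i) : ‖y‖ ≤ 1 := by
    rw [hnorm]
    exact_mod_cast wordLength_le (r := 1)
      (by rw [one_nsmul]; exact mem_subgroupUnion.2 ⟨i, hy⟩)
  have hball : 2 * #{u : G | ‖u‖ < (r : ℝ) + 1} ≤ Fintype.card G := by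
    simp only [hnorm, ← Nat.cast_add_one, Nat.cast_lt, Nat.lt_succ_iff]
    have h0 : 0 ∈ subgroupUnion K := mem_subgroupUnion.2 ⟨Classical.arbitrary ι, zero_mem _⟩
    calc _ ≤ 2 * #(subgroupUnion K) ^ r := by gcongr; exact card_wordLength_le hneg hgen h0 r
      _ ≤ 2 * (Fintype.card ι * q) ^ r := by gcongr; exact card_subgroupUnion_le hq
      _ ≤ Fintype.card G := hr
  exact ⟨inferInstance, fun hf =>
    hf.le_three_mul_of_iSup_eq_top hK hD hnorm_le_one (by positivity) hball⟩

end SubgroupFamily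

section MomentCurve

universe u

variable {F : Type*} [Field F] {D : ℕ}

/-- The line in `F ^ D` through the origin and the point `(1, x, …, x ^ (D - 1))` of the moment
curve; any `D` of these lines generate `F ^ D`. -/
def momentLine (D : ℕ) (x : F) : AddSubgroup (Fin D → F) :=
  (Submodule.span F {fun j : Fin D => x ^ (j : ℕ)}).toAddSubgroup

theorem card_momentLine_le [Finite F] (x : F) : Nat.card (momentLine D x) ≤ Nat.card F := by
  let param (c : F) : momentLine D x :=
    ⟨c • fun j : Fin D => x ^ (j : ℕ), Submodule.mem_span_singleton.2 ⟨c, rfl⟩⟩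
  refine Nat.card_le_card_of_surjective param fun y => ?_
  obtain ⟨c, hc⟩ := Submodule.mem_span_singleton.1 y.2
  exact ⟨c, Subtype.ext hc⟩

theorem iSup_momentLine_eq_top {t : Finset F} (ht : D ≤ #t) : ⨆ x ∈ t, momentLine D x = ⊤ := by
  obtain ⟨v⟩ := Function.Embedding.nonempty_of_card_le (α := Fin D) (β := t) (by simpa using ht)
  have hdet : (Matrix.vandermonde fun i => (v i : F)).det ≠ 0 :=
    Matrix.det_vandermonde_ne_zero_iff.2 (Subtype.val_injective.comp v.injective)
  have hspan :
      Submodule.span F (Set.range fun (i j : Fin D) => (v i : F) ^ (j : ℕ)) = ⊤ :=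
    (Matrix.linearIndependent_rows_iff_isUnit.2
      ((Matrix.isUnit_iff_isUnit_det _).2 hdet.isUnit)).span_eq_top_of_card_eq_finrank' (by simp)
  refine eq_top_iff.2 fun g _ => ?_
  have hg := hspan ▸ Submodule.mem_top (x := g)
  induction hg using Submodule.closure_induction with
  | zero => exact zero_mem _
  | add g h _ _ hg hh => exact add_mem (hg trivial) (hh trivial)
  | smul_mem c g hg =>
    obtain ⟨i, rfl⟩ := hg
    exact (le_iSup₂ (f := fun x (_ : x ∈ t) => momentLine D x) (v i) (v i).2)
      (Submodule.mem_span_singleton.2 ⟨c, rfl⟩)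

theorem exists_metricSpace_pi_le_six_mul [Fintype F] (hD0 : 0 < D) (hD : 2 * D ≤ Fintype.card F) :
    ∃ _ : MetricSpace (Fin D → F), ∀ {H : Type u} [NormedAddCommGroup H] [InnerProductSpace ℝ H]
      {f : (Fin D → F) → H} {s C : ℝ}, IsBiLipschitzWith f s C → (D : ℝ) ≤ 6 * C := by
  set q := Fintype.card F
  have hball : 2 * (q * q) ^ ((D - 1) / 2) ≤ Fintype.card (Fin D → F) := by
    calc 2 * (q * q) ^ ((D - 1) / 2) = 2 * q ^ (2 * ((D - 1) / 2)) := by rw [← sq, ← pow_mul]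
      _ ≤ q * q ^ (D - 1) := by gcongr <;> omega
      _ = Fintype.card (Fin D → F) := by
          rw [← pow_succ', Nat.sub_add_cancel hD0, Fintype.card_fun, Fintype.card_fin]
  obtain ⟨inst, h⟩ := exists_metricSpace_le_three_mul_of_iSup_eq_top
    (fun t => iSup_momentLine_eq_top (t := t)) hD
    (fun x => (card_momentLine_le x).trans_eq Nat.card_eq_fintype_card) hball
  refine ⟨inst, fun hf => ?_⟩
  have hradius : (D : ℝ) ≤ 2 * (((D - 1) / 2 : ℕ) + 1) := by
    exact_mod_cast (by omega : D ≤ 2 * ((D - 1) / 2 + 1))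
  linarith [h hf]

theorem exists_metricSpace_card_le_pow_le_six_mul (hD : 0 < D) :
    ∃ (X : Type) (_ : MetricSpace X) (_ : Fintype X), Fintype.card X ≤ (4 * D) ^ D ∧
      ∀ {H : Type u} [NormedAddCommGroup H] [InnerProductSpace ℝ H] {f : X → H} {s C : ℝ},
        IsBiLipschitzWith f s C → (D : ℝ) ≤ 6 * C := by
  obtain ⟨p, hp, hpD, hp_le⟩ := Nat.exists_prime_lt_and_le_two_mul (2 * D) (by omega)
  have : Fact p.Prime := ⟨hp⟩
  obtain ⟨inst, h⟩ := exists_metricSpace_pi_le_six_mul (F := ZMod p) hD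
    (by rw [ZMod.card]; exact hpD.le)
  refine ⟨Fin D → ZMod p, inst, inferInstance, ?_, h⟩
  rw [Fintype.card_fun, ZMod.card, Fintype.card_fin]
  gcongr
  omega

end MomentCurve

section PrescribedCardinality

universe u

theorem exists_isometry_card_eq {Y : Type u} [MetricSpace Y] [Fintype Y] {n : ℕ}
    (hn : Fintype.card Y ≤ n) :
    ∃ (X : Type u) (_ : MetricSpace X) (_ : Fintype X) (e : Y → X),
      Fintype.card X = n ∧ Isometry e := by
  classical
  let _ : MetricSpace (Y ⊕ ℕ) := Metric.metricSpaceSum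
  obtain ⟨T, hT, hTn⟩ := Infinite.exists_superset_card_eq (Finset.univ.map (.inl : Y ↪ Y ⊕ ℕ)) n
    (by simpa using hn)
  exact ⟨T, inferInstance, inferInstance, fun y => ⟨.inl y, hT (by simp)⟩, by simpa using hTn,
    fun x y => Metric.isometry_inl x y⟩

theorem exists_pow_le_and_log_div_log_log_le {n : ℕ} (hn : 1 ≤ Real.log (Real.log n)) :
    ∃ D : ℕ, 0 < D ∧ (4 * D) ^ D ≤ n ∧ Real.log n / Real.log (Real.log n) ≤ 4 * D := by
  set L := Real.log n with hL_def
  set l := Real.log L with hl_def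
  have hl : 0 < l := one_pos.trans_le hn
  have hL : 0 < L := (Real.log_natCast_nonneg n).lt_of_ne fun (h : 0 = L) => by
    simp [hl_def, ← h] at hl
  have hn0 : (0 : ℝ) < n := n.cast_nonneg.lt_of_ne fun h => by simp [hL_def, ← h] at hL
  have htwo_mul : 2 * l ≤ L := by
    have hhalf := Real.log_le_sub_one_of_pos (half_pos hL)
    rw [Real.log_div hL.ne' two_ne_zero] at hhalf
    linarith [Real.log_two_lt_d9]
  have hone : 1 ≤ L / (2 * l) := (one_le_div (by positivity)).2 htwo_mul
  -- With this `D`, `4 * D ≤ L ^ 2` and hence `log ((4 * D) ^ D) ≤ D * (2 * l) ≤ L`.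
  set D := ⌊L / (2 * l)⌋₊
  have hD : 0 < D := Nat.floor_pos.2 hone
  have hD_mul : D * (2 * l) ≤ L :=
    (le_div_iff₀ (by positivity)).1 (Nat.floor_le (zero_le_one.trans hone))
  refine ⟨D, hD, ?_, ?_⟩
  · have hsq : (4 * D : ℝ) ≤ L ^ 2 := by
      have : (D : ℝ) ≤ D * l := le_mul_of_one_le_right D.cast_nonneg hn
      nlinarith
    rw [← Nat.cast_le (α := ℝ), ← Real.log_le_log_iff (by positivity) hn0]
    push_cast
    calc Real.log ((4 * D) ^ D) = D * Real.log (4 * D) := Real.log_pow _ _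
      _ ≤ D * Real.log (L ^ 2) := by gcongr
      _ = D * (2 * l) := by rw [Real.log_pow, Nat.cast_two]
      _ ≤ L := hD_mul
  · have hlt : L / (2 * l) < D + 1 := Nat.lt_floor_add_one _
    have hD_one : (1 : ℝ) ≤ D := mod_cast hD
    calc L / l = 2 * (L / (2 * l)) := by field_simp
      _ ≤ 4 * D := by linarith

theorem one_le_log_log {n : ℕ} (hn : 16 ≤ n) : 1 ≤ Real.log (Real.log n) := by
  have hlog : Real.exp 1 ≤ Real.log n := by
    calc Real.exp 1 ≤ 4 * Real.log 2 := by linarith [Real.exp_one_lt_d9, Real.log_two_gt_d9]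
      _ = Real.log (2 ^ 4) := by rw [Real.log_pow]; norm_cast
      _ ≤ Real.log n := Real.log_le_log (by norm_num) (by norm_num; exact_mod_cast hn)
  rwa [Real.le_log_iff_exp_le ((Real.exp_pos 1).trans_le hlog)]

theorem exists_metricSpace_card_eq_log_div_log_log_le {n : ℕ} (hn : 16 ≤ n) :
    ∃ (X : Type) (_ : MetricSpace X) (_ : Fintype X), Fintype.card X = n ∧
      ∀ {H : Type u} [NormedAddCommGroup H] [InnerProductSpace ℝ H] {f : X → H} {s C : ℝ},
        IsBiLipschitzWith f s C → Real.log n / Real.log (Real.log n) ≤ 24 * C := by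
  obtain ⟨D, hD, hDn, hlog⟩ := exists_pow_le_and_log_div_log_log_le (one_le_log_log hn)
  obtain ⟨Y, _, _, hY, h⟩ := exists_metricSpace_card_le_pow_le_six_mul hD
  obtain ⟨X, instX, instF, e, hX, he⟩ := exists_isometry_card_eq (hY.trans hDn)
  refine ⟨X, instX, instF, hX, fun hf => ?_⟩
  have := h (hf.comp (isBiLipschitzWith_of_isometry he))
  linarith

theorem exists_forall_metricSpace_log_div_log_log_le :
    ∃ M : ℝ, 0 < M ∧ ∀ n : ℕ, ∃ (X : Type) (_ : MetricSpace X) (_ : Fintype X),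
      Fintype.card X = n ∧
        ∀ {H : Type u} [NormedAddCommGroup H] [InnerProductSpace ℝ H] {f : X → H} {s C : ℝ},
          IsBiLipschitzWith f s C → Real.log n / Real.log (Real.log n) ≤ M * C := by
  obtain ⟨M, hM⟩ := ((Set.finite_lt_nat 16).image
    fun n : ℕ => Real.log n / Real.log (Real.log n)).bddAbove
  refine ⟨max 24 M, by positivity, fun n => ?_⟩
  rcases lt_or_ge n 16 with hn | hn
  · refine ⟨Finset.range n, inferInstance, inferInstance, by simp, fun {H} _ _ f s C hf => ?_⟩
    calc Real.log n / Real.log (Real.log n) ≤ M := hM ⟨n, hn, rfl⟩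
      _ ≤ max 24 M := le_max_right _ _
      _ ≤ max 24 M * C := le_mul_of_one_le_right (by positivity) hf.one_le
  · obtain ⟨X, instX, instF, hX, h⟩ := exists_metricSpace_card_eq_log_div_log_log_le hn
    refine ⟨X, instX, instF, hX, fun hf => (h hf).trans ?_⟩
    have := zero_le_one.trans hf.one_le
    gcongr
    exact le_max_left _ _

end PrescribedCardinality

theorem mainTheorem9_general {R H : Type*} [MetricSpace R] [NormedAddCommGroup H]
    [InnerProductSpace ℝ H] (hR : ∃ ψ : R → H, IsBiLipschitzEmbedding ψ) :
    ∃ c : ℝ, 0 < c ∧ ∀ n : ℕ, 1 ≤ n →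
      ∃ (X : Type) (_ : MetricSpace X) (_ : Fintype X), Fintype.card X = n ∧
        ∀ f : X → R, IsBiLipschitzEmbedding f →
          c * (Real.log n / Real.log (Real.log n)) ≤ distortion f := by
  obtain ⟨ψ, s₀, D₀, hψ⟩ := hR
  have hD₀ : 0 < D₀ := one_pos.trans_le hψ.one_le
  obtain ⟨M, hM, hX⟩ := exists_forall_metricSpace_log_div_log_log_le
  refine ⟨(M * D₀)⁻¹, by positivity, fun n _ => ?_⟩
  obtain ⟨X, instX, instF, hcard, h⟩ := hX n
  refine ⟨X, instX, instF, hcard, fun f hf => le_distortion hf fun s D hfD => ?_⟩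
  rw [inv_mul_le_iff₀ (by positivity), mul_assoc]
  exact h (hψ.comp hfD)

theorem mainTheorem9 (d : ℕ) (R : Type*) [MetricSpace R]
    [ChartedSpace (EuclideanSpace ℝ (Fin d)) R] [IsManifold (𝓡 d) ∞ R]
    [RiemannianBundle (fun x : R => TangentSpace (𝓡 d) x)]
    [IsContMDiffRiemannianBundle (𝓡 d) ∞ (EuclideanSpace ℝ (Fin d))
      (fun x : R => TangentSpace (𝓡 d) x)]
    [IsRiemannianManifold (𝓡 d) R]
    (hR : ∃ ψ : R → EllTwo, IsBiLipschitzEmbedding ψ) :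
    ∃ c : ℝ, 0 < c ∧ ∀ n : ℕ, 1 ≤ n →
      ∃ (X : Type) (_ : MetricSpace X) (_ : Fintype X), Fintype.card X = n ∧
        ∀ f : X → R, IsBiLipschitzEmbedding f →
          c * (Real.log n / Real.log (Real.log n)) ≤ distortion f :=
  mainTheorem9_general hR
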